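/- Let $R$ be an associative unital ring, and let $\mathrm{Mod}\text{-}R$ be the category of right $R$-modules. **Notation.** For a module $M$, $\mathrm{Add}(M)$ is the class of all modules isomorphic to a direct summand of an arbitrary (set-indexed) direct sum of copies of $M$; $\mathrm{Gen}(M)$ is the class of all epimorphic images of modules in $\mathrm{Add}(M)$; and $\mathrm{Pres}(M)$ is the class of all modules $X$ that admit an exact sequence $M_1\to M_0\to X\to 0$ with $M_0,M_1\in\mathrm{Add}(M)$. For a morphism $\sigma:P_1\to P_0$ between projective modules, $\mathscr D_\sigma$ is the class of all modules $M$ such that $\mathrm{Hom}_R(\sigma,M):\mathrm{Hom}_R(P_0,M)\to\mathrm{Hom}_R(P_1,M)$ is surjective. A module $T$ is * *finendo* if it is finitely generated as a module over its endomorphism ring; * *quasitilting* if $\mathrm{Pres}(T)=\mathrm{Gen}(T)$ and $T$ is $\mathrm{Ext}$-projective in $\mathrm{Gen}(T)$, i.e. $T\in\mathrm{Gen}(T)$ and $\mathrm{Ext}^1_R(T,X)=0$ for all $X\in\mathrm{Gen}(T)$; * *silting* if there is an exact sequence $P_1\xrightarrow{\sigma}P_0\to T\to 0$ with $P_0,P_1$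 projective such that $\mathrm{Gen}(T)=\mathscr D_\sigma$. Let $\mathscr A$ be an abelian category with enough projective objects, and let $\mathscr T$ be an additive full subcategory of $\mathscr A$, that is, one closed under isomorphisms, finite direct sums (including the zero object) and direct summands. A morphism $f:A\to T$ is a *left $\mathscr T$-approximation* of $A$ if $T\in\mathscr T$ and every morphism from $A$ to an object of $\mathscr T$ factors through $f$; a morphism $\varphi:T\to A$ is a *right $\mathscr T$-approximation* of $A$ if $T\in\mathscr T$ and every morphism from an object of $\mathscr T$ to $A$ factors through $\varphi$. For an object $T$, $\mathrm{Fac}(T)$ is the class of all quotients of $T$. The subcategory $\mathscr T$ is called *support $\tau$-tilting* if 1. $\mathrm{Ext}^1_{\mathscr A}(T_1,X)=0$ for all $T_1,T_2\in\mathscr T$ and all $X\in\mathrm{Fac}(T_2)$; 2. for every projective object $P$ of $\mathscr A$ there is an exact sequence $P\xrightarrow{f}T^0\to T^1\to 0$ with $T^0,T^1\in\mathscr T$ and $f$ a left $\mathscr T$-approximation of $P$; 3. $\mathscr T$ is contravariantly finite in $\mathscr A$, i.e. every object of $\mathscr A$ has a right $\mathscr T$-approximation. **Statement.** (a) If $T$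 is a finendo quasitilting $R$-module, then $\mathrm{Add}(T)$ is a support $\tau$-tilting subcategory of $\mathrm{Mod}\text{-}R$. (b) If $S$ is a silting $R$-module, then $\mathrm{Add}(S)$ is a support $\tau$-tilting subcategory of $\mathrm{Mod}\text{-}R$. -/

import Mathlib

universe v u

namespace TauTilting

open CategoryTheory CategoryTheory.Limits CategoryTheory.Abelian

section Category

/-- The vanishing of `Ext¹(X, Y)`. -/
def ExtOneVanishes {C : Type u} [Category.{v} C] [Abelian C] [HasExt.{v} C] (X Y : C) : Prop :=
  Subsingleton (Ext X Y 1)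

/-- A morphism `φ : X ⟶ A` is a right `P`-approximation of `A`: the object `X` is in `P` and every
morphism from an object of `P` to `A` factors through `φ`. -/
def IsRightApproximation {C : Type u} [Category.{v} C] (P : ObjectProperty C) {X A : C}
    (φ : X ⟶ A) : Prop :=
  P X ∧ ∀ (X' : C), P X' → ∀ g : X' ⟶ A, ∃ h : X' ⟶ X, h ≫ φ = g

/-- A morphism `φ : A ⟶ X` is a left `P`-approximation of `A`: the object `X` is in `P` and every
morphism from `A` to an object of `P` factors through `φ`. -/
def IsLeftApproximation {C : Type u} [Category.{v} C] (P : ObjectProperty C) {A X : C}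
    (φ : A ⟶ X) : Prop :=
  P X ∧ ∀ (X' : C), P X' → ∀ g : A ⟶ X', ∃ h : X ⟶ X', φ ≫ h = g

/-- Every object has a right `P`-approximation. -/
def IsContravariantlyFinite {C : Type u} [Category.{v} C] (P : ObjectProperty C) : Prop :=
  ∀ A : C, ∃ (X : C) (φ : X ⟶ A), IsRightApproximation P φ

/-- The full subcategory `Fac(P)` of factors (quotients) of objects of `P`. -/
def Fac {C : Type u} [Category.{v} C] (P : ObjectProperty C) : ObjectProperty C :=
  fun X => ∃ (T : C) (p : T ⟶ X), P T ∧ Epi p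

/-- Additive full subcategories, as (isomorphism invariant) properties of objects: they contain the
zero objects and are closed under finite direct sums and under direct summands. -/
structure IsAdditiveSubcategory {C : Type u} [Category.{v} C] [Abelian C]
    (P : ObjectProperty C) : Prop where
  iso_mem : ∀ {X Y : C}, (X ≅ Y) → P X → P Y
  zero_mem : ∀ {X : C}, IsZero X → P X
  biprod_mem : ∀ {X Y : C}, P X → P Y → P (X ⊞ Y)
  summand_mem : ∀ {X Y : C}, Retract X Y → P Y → P X

/-- Weak support `τ`-tilting subcategories of an abelian category with enough projectives. -/
structure IsWeakSupportTauTilting {C : Type u} [Category.{v} C] [Abelian C] [HasExt.{v} C]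
    [EnoughProjectives C] (P : ObjectProperty C) : Prop where
  additive : IsAdditiveSubcategory P
  ext_vanishing : ∀ T₁ T₂ : C, P T₁ → P T₂ →
    ∀ X : C, Fac (fun Y => Nonempty (Y ≅ T₂)) X → ExtOneVanishes T₁ X
  exists_presentation : ∀ Q : C, Projective Q →
    ∃ (T₀ T₁ : C) (f : Q ⟶ T₀) (g : T₀ ⟶ T₁) (w : f ≫ g = 0),
      (ShortComplex.mk f g w).Exact ∧ Epi g ∧ P T₀ ∧ P T₁ ∧ IsLeftApproximation P f

/-- Support `τ`-tilting subcategories of an abelian category with enough projectives. -/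
structure IsSupportTauTilting {C : Type u} [Category.{v} C] [Abelian C] [HasExt.{v} C]
    [EnoughProjectives C] (P : ObjectProperty C) : Prop extends IsWeakSupportTauTilting P where
  contravariantlyFinite : IsContravariantlyFinite P

/-- The object `T` is `Ext`-projective in `P`. -/
def IsExtProjectiveIn {C : Type u} [Category.{v} C] [Abelian C] [HasExt.{v} C]
    (P : ObjectProperty C) (T : C) : Prop :=
  P T ∧ ∀ X : C, P X → ExtOneVanishes T X

/-- The class `𝒟_σ` of all objects `M` such that `Hom(σ, M)` is surjective. -/
def homSurjectiveClass {C : Type u} [Category.{v} C] {P₁ P₀ : C} (σ : P₁ ⟶ P₀) :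
    ObjectProperty C :=
  fun M => Function.Surjective (fun k : P₀ ⟶ M => σ ≫ k)

end Category

section Modules

/-- `Add(M)`: the modules isomorphic to a direct summand of a direct sum of copies of `M`. -/
def AddClass {A : Type u} [Ring A] (M : ModuleCat.{u} A) : ObjectProperty (ModuleCat.{u} A) :=
  fun X => ∃ J : Type u, Nonempty (Retract X (ModuleCat.of A (J →₀ M)))

/-- `Gen(M)`: the epimorphic images of modules in `Add(M)`. -/
def Gen {A : Type u} [Ring A] (M : ModuleCat.{u} A) : ObjectProperty (ModuleCat.{u} A) :=
  Fac (AddClass M)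

/-- `Pres(M)`: the modules `X` with an exact sequence `M₁ ⟶ M₀ ⟶ X ⟶ 0` where `M₁` and `M₀` are in
`Add(M)`. -/
def Pres {A : Type u} [Ring A] (M : ModuleCat.{u} A) : ObjectProperty (ModuleCat.{u} A) :=
  fun X => ∃ (M₁ M₀ : ModuleCat.{u} A) (f : M₁ ⟶ M₀) (g : M₀ ⟶ X) (w : f ≫ g = 0),
    AddClass M M₁ ∧ AddClass M M₀ ∧ (ShortComplex.mk f g w).Exact ∧ Epi g

/-- The module `T` is finitely generated over its endomorphism ring. -/
def IsFinendo {A : Type u} [Ring A] (T : ModuleCat.{u} A) : Prop :=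
  Module.Finite (Module.End A T) T

/-- Quasitilting modules. -/
def IsQuasitilting {A : Type u} [Ring A] (T : ModuleCat.{u} A) : Prop :=
  Pres T = Gen T ∧ IsExtProjectiveIn (Gen T) T

/-- Silting modules: there is a projective presentation `P₁ ⟶ P₀ ⟶ S ⟶ 0` with first map `σ` such
that `Gen(S) = 𝒟_σ`. -/
def IsSilting {A : Type u} [Ring A] (S : ModuleCat.{u} A) : Prop :=
  ∃ (P₁ P₀ : ModuleCat.{u} A) (σ : P₁ ⟶ P₀) (π : P₀ ⟶ S) (w : σ ≫ π = 0),
    Projective P₁ ∧ Projective P₀ ∧ (ShortComplex.mk σ π w).Exact ∧ Epi π ∧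
      Gen S = homSurjectiveClass σ

end Modules

end TauTilting

namespace TauTilting

open CategoryTheory CategoryTheory.Limits CategoryTheory.Abelian

/-! ### Extension and lifting of maps from vanishing of `Ext¹`. -/

section Category

variable {C : Type u} [Category.{v} C] [Abelian C] [HasExt.{v} C]

/-! Finitely many generators of `T` over its endomorphism ring form one vector in a finite power of
`T` whose images under linear maps reach every element of every module in `Gen(T)`. So every
projective `Q` has a left `Gen(T)`-approximation `Q ⟶ M` with `M` in `Add(T)`
(`IsFinendo.exists_approximation`). Its cokernel is `Ext`-projective in `Gen(T)`
(`ExtOneVanishes.cokernel_of_factors`), hence lies in `Add(T)` because `Pres(T) = Gen(T)` makes a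
presentation of it split (`addClass_of_isExtProjectiveIn`).

Part (b) reduces to part (a): silting modules are quasitilting and finendo. -/

lemma ExtOneVanishes.exists_extension {S : ShortComplex C} (hS : S.ShortExact) {X : C}
    (h : ExtOneVanishes S.X₃ X) (g : S.X₁ ⟶ X) : ∃ g' : S.X₂ ⟶ X, S.f ≫ g' = g := by
  have : Subsingleton (Ext S.X₃ X 1) := h
  obtain ⟨y, hy⟩ := Ext.contravariant_sequence_exact₁ hS X (Ext.mk₀ g) (add_zero 1)
    (Subsingleton.elim _ _)
  obtain ⟨y, rfl⟩ := (Ext.mk₀_bijective _ _).2 y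
  rw [Ext.mk₀_comp_mk₀] at hy
  exact ⟨y, (Ext.mk₀_bijective _ _).1 hy⟩

lemma ExtOneVanishes.exists_lift {S : ShortComplex C} (hS : S.ShortExact) {M : C}
    (h : ExtOneVanishes M S.X₁) (g : M ⟶ S.X₃) : ∃ g' : M ⟶ S.X₂, g' ≫ S.g = g := by
  have : Subsingleton (Ext M S.X₁ 1) := h
  obtain ⟨y, hy⟩ := Ext.covariant_sequence_exact₃ M hS (Ext.mk₀ g) (zero_add 1)
    (Subsingleton.elim _ _)
  obtain ⟨y, rfl⟩ := (Ext.mk₀_bijective _ _).2 y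
  rw [Ext.mk₀_comp_mk₀] at hy
  exact ⟨y, (Ext.mk₀_bijective _ _).1 hy⟩

lemma ExtOneVanishes.of_exists_extension {S : ShortComplex C} (hS : S.ShortExact) {X : C}
    (h₂ : ExtOneVanishes S.X₂ X) (h : ∀ g : S.X₁ ⟶ X, ∃ g' : S.X₂ ⟶ X, S.f ≫ g' = g) :
    ExtOneVanishes S.X₃ X := by
  have : Subsingleton (Ext S.X₂ X 1) := h₂
  refine subsingleton_of_forall_eq 0 fun x ↦ ?_
  obtain ⟨y, rfl⟩ := Ext.contravariant_sequence_exact₃ hS X x (Subsingleton.elim _ _) (add_zero 1)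
  obtain ⟨y, rfl⟩ := (Ext.mk₀_bijective _ _).2 y
  obtain ⟨g, rfl⟩ := h y
  rw [← Ext.mk₀_comp_mk₀, ShortComplex.ShortExact.extClass_comp_assoc]

lemma ExtOneVanishes.of_projective (Q X : C) [Projective Q] : ExtOneVanishes Q X :=
  subsingleton_of_forall_eq 0 Ext.eq_zero_of_projective

lemma ExtOneVanishes.of_retract {M N X : C} (r : Retract M N) (h : ExtOneVanishes N X) :
    ExtOneVanishes M X := by
  have : Subsingleton (Ext N X 1) := h
  refine subsingleton_of_forall_eq 0 fun x ↦ ?_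
  rw [← Ext.mk₀_id_comp x, ← r.retract, ← Ext.mk₀_comp_mk₀_assoc,
    Subsingleton.elim ((Ext.mk₀ r.r).comp x (zero_add 1)) 0, Ext.comp_zero]

omit [HasExt.{v} C] in
lemma shortExact_kernel {X Y : C} (p : X ⟶ Y) [Epi p] :
    (ShortComplex.mk (kernel.ι p) p (kernel.condition p)).ShortExact where
  exact := ShortComplex.exact_kernel p

/-- A map from the image of `f` to `X` extends to `M`: precomposed with the epimorphism from `Q`
onto the image it factors through `f`, and that epimorphism cancels. -/
lemma ExtOneVanishes.cokernel_of_factors {Q M X : C} (f : Q ⟶ M)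
    (hM : ExtOneVanishes M X) (h : ∀ g : Q ⟶ X, ∃ g' : M ⟶ X, f ≫ g' = g) :
    ExtOneVanishes (cokernel f) X := by
  refine of_exists_extension (shortExact_kernel (cokernel.π f)) hM fun g ↦ ?_
  obtain ⟨g', hg'⟩ := h (Abelian.factorThruImage f ≫ g)
  refine ⟨g', ?_⟩
  rw [← cancel_epi (Abelian.factorThruImage f), ← hg', ← Category.assoc]
  exact congr($(Abelian.image.fac f) ≫ g')

end Category

/-! ### The classes `Add(T)` and `Gen(T)`. -/

section Modules

variable {A : Type u} [Ring A]

lemma AddClass.of_retract {T X Y : ModuleCat.{u} A} (r : Retract X Y) (h : AddClass T Y) :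
    AddClass T X := by
  obtain ⟨J, ⟨s⟩⟩ := h
  exact ⟨J, ⟨r.trans s⟩⟩

lemma AddClass.finsupp_self (T : ModuleCat.{u} A) (J : Type u) :
    AddClass T (ModuleCat.of A (J →₀ T)) := ⟨J, ⟨Retract.refl _⟩⟩

lemma AddClass.self (T : ModuleCat.{u} A) : AddClass T T :=
  ⟨PUnit, ⟨Retract.ofIso (Finsupp.uniqueLinearEquiv A T PUnit.unit).symm.toModuleIso⟩⟩

lemma AddClass.finsupp {T X : ModuleCat.{u} A} (h : AddClass T X) (J : Type u) :
    AddClass T (ModuleCat.of A (J →₀ X)) := by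
  obtain ⟨K, ⟨r⟩⟩ := h
  refine .of_retract (Y := ModuleCat.of A (J →₀ (K →₀ T)))
    ⟨ModuleCat.ofHom (Finsupp.mapRange.linearMap r.i.hom),
      ModuleCat.ofHom (Finsupp.mapRange.linearMap r.r.hom), ?_⟩
    ⟨J × K, ⟨Retract.ofIso (Finsupp.curryLinearEquiv A).symm.toModuleIso⟩⟩
  ext1
  change (Finsupp.mapRange.linearMap r.r.hom) ∘ₗ (Finsupp.mapRange.linearMap r.i.hom) = LinearMap.id
  rw [← Finsupp.mapRange.linearMap_comp, ← ModuleCat.hom_comp, r.retract]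
  exact Finsupp.mapRange.linearMap_id

lemma isAdditiveSubcategory_addClass (T : ModuleCat.{u} A) :
    IsAdditiveSubcategory (AddClass T) where
  iso_mem e h := .of_retract (Retract.ofIso e.symm) h
  zero_mem h := ⟨PUnit, ⟨⟨0, 0, h.eq_of_src _ _⟩⟩⟩
  biprod_mem := by
    rintro X Y ⟨J, ⟨r⟩⟩ ⟨K, ⟨s⟩⟩
    refine .of_retract (Y := ModuleCat.of A (J →₀ T) ⊞ ModuleCat.of A (K →₀ T))
      ⟨biprod.map r.i s.i, biprod.map r.r s.r, ?_⟩
      ⟨J ⊕ K, ⟨Retract.ofIso ((ModuleCat.biprodIsoProd _ _).trans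
        (Finsupp.sumFinsuppLEquivProdFinsupp A).symm.toModuleIso)⟩⟩
    apply biprod.hom_ext <;> simp
  summand_mem r h := .of_retract r h

/-- Every module in `Gen(T)` is an epimorphic image of a direct sum of copies of `T`. -/
lemma gen_iff {T X : ModuleCat.{u} A} :
    Gen T X ↔ ∃ (J : Type u) (p : (J →₀ T) →ₗ[A] X), Function.Surjective p := by
  constructor
  · rintro ⟨Y, p, ⟨J, ⟨r⟩⟩, hp⟩
    refine ⟨J, (r.r ≫ p).hom, ?_⟩
    have : Epi r.r := r.splitEpi.epi
    rw [← ModuleCat.epi_iff_surjective]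
    infer_instance
  · rintro ⟨J, p, hp⟩
    exact ⟨_, ModuleCat.ofHom p, AddClass.finsupp_self T J, (ModuleCat.epi_iff_surjective _).2 hp⟩

lemma Gen.of_addClass {T X : ModuleCat.{u} A} (h : AddClass T X) : Gen T X :=
  ⟨X, 𝟙 X, h, inferInstance⟩

/-- For a projective cover map `F ⟶ T`, not necessarily minimal, the kernel of `F^(J) ⟶ T^(J)` is
the direct sum of the kernels, so maps out of it extend coordinate by coordinate. -/
lemma ExtOneVanishes.finsupp {T X : ModuleCat.{u} A} (h : ExtOneVanishes T X) (J : Type u) :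
    ExtOneVanishes (ModuleCat.of A (J →₀ T)) X := by
  obtain ⟨F, hF, p, hp⟩ : ∃ (F : ModuleCat.{u} A) (_ : Projective F) (p : F →ₗ[A] T),
      Function.Surjective p :=
    ⟨Projective.over T, inferInstance, (Projective.π T).hom,
      (ModuleCat.epi_iff_surjective _).1 inferInstance⟩
  let q : (J →₀ F) →ₗ[A] (J →₀ T) := Finsupp.mapRange.linearMap p
  have hq : Function.Surjective q := Finsupp.mapRange_surjective _ (map_zero p) hp
  have hT := LinearMap.shortExact_shortComplexKer hp
  have hJ : q.shortComplexKer.ShortExact :=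
    @LinearMap.shortExact_shortComplexKer A _ (J →₀ F) _ _ (J →₀ T) _ _ q hq
  have : Projective (ModuleCat.of A (J →₀ F)) := by
    have : Module.Projective A F := inferInstance
    classical
    have : Module.Projective A (J →₀ F) :=
      .of_equiv (finsuppLequivDFinsupp (M := F) A).symm
    exact ModuleCat.projective_of_categoryTheory_projective (ModuleCat.of A (J →₀ F))
  refine of_exists_extension hJ (of_projective (ModuleCat.of A (J →₀ F)) X) fun g ↦ ?_
  have key (j : J) : ∃ g' : F →ₗ[A] X, ∀ (x : LinearMap.ker p)
      (hx : Finsupp.single j x.1 ∈ LinearMap.ker q), g' x = g.hom ⟨Finsupp.single j x.1, hx⟩ := by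
    have hk (x : LinearMap.ker p) : Finsupp.lsingle (R := A) j x.1 ∈ LinearMap.ker q := by
      simp [q, Finsupp.mapRange_single, LinearMap.mem_ker.1 x.2]
    obtain ⟨g', hg'⟩ := h.exists_extension hT (ModuleCat.ofHom (g.hom ∘ₗ
      LinearMap.codRestrict (LinearMap.ker q) (Finsupp.lsingle j ∘ₗ (LinearMap.ker p).subtype) hk))
    exact ⟨g'.hom, fun x hx ↦ congr($hg' x)⟩
  choose g' hg' using key
  refine ⟨ModuleCat.ofHom (Finsupp.lsum ℕ g'), ?_⟩
  ext x
  obtain ⟨x, hx⟩ := x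
  have hx' (j : J) : x j ∈ LinearMap.ker p := by
    simpa [q] using DFunLike.congr_fun (LinearMap.mem_ker.1 hx) j
  have hs (j : J) : Finsupp.single j (x j) ∈ LinearMap.ker q := by
    simp [q, Finsupp.mapRange_single, LinearMap.mem_ker.1 (hx' j)]
  have hsum : (⟨x, hx⟩ : LinearMap.ker q) = ∑ j ∈ x.support, ⟨Finsupp.single j (x j), hs j⟩ := by
    ext1
    rw [AddSubmonoidClass.coe_finsetSum]
    exact (Finsupp.sum_single x).symm
  change Finsupp.lsum ℕ g' x = g.hom ⟨x, hx⟩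
  rw [hsum, map_sum, Finsupp.lsum_apply, Finsupp.sum]
  exact Finset.sum_congr rfl fun j _ ↦ hg' j ⟨x j, hx' j⟩ (hs j)

lemma ExtOneVanishes.of_addClass {T M X : ModuleCat.{u} A} (h : ExtOneVanishes T X)
    (hM : AddClass T M) : ExtOneVanishes M X := by
  obtain ⟨J, ⟨r⟩⟩ := hM
  exact (h.finsupp J).of_retract r

lemma Gen.of_epi {T X Y : ModuleCat.{u} A} (h : Gen T X) (p : X ⟶ Y) [Epi p] : Gen T Y := by
  obtain ⟨Z, q, hZ, hq⟩ := h
  exact ⟨Z, q ≫ p, hZ, inferInstance⟩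

/-- A module in `Gen(T)` which is `Ext`-projective in `Gen(T)` lies in `Add(T)`, when
`Pres(T) = Gen(T)`. -/
lemma addClass_of_isExtProjectiveIn {T M : ModuleCat.{u} A} (hT : Pres T = Gen T)
    (hM : IsExtProjectiveIn (Gen T) M) : AddClass T M := by
  obtain ⟨hM, hext⟩ := hM
  rw [← hT] at hM
  obtain ⟨M₁, M₀, f, g, w, h₁, h₀, hfg, hg⟩ := hM
  have hK : Gen T (kernel g) := by
    have : Epi (kernel.lift g f w) := hfg.epi_kernelLift
    exact ⟨M₁, kernel.lift g f w, h₁, this⟩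
  -- The kernel is in `Gen(T)`, so the identity of `M` lifts and `g` splits.
  obtain ⟨s, hs⟩ := (hext _ hK).exists_lift (shortExact_kernel g) (𝟙 M)
  exact .of_retract ⟨s, g, hs⟩ h₀

/-- The approximation is the evaluation map from one copy of `T` for each homomorphism `T ⟶ M`. -/
lemma isContravariantlyFinite_addClass (T : ModuleCat.{u} A) :
    IsContravariantlyFinite (AddClass T) := by
  intro M
  refine ⟨ModuleCat.of A ((T →ₗ[A] M) →₀ T), ModuleCat.ofHom (Finsupp.lsum ℕ id),
    AddClass.finsupp_self _ _, ?_⟩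
  rintro X ⟨J, ⟨r⟩⟩ g
  refine ⟨r.i ≫ ModuleCat.ofHom (Finsupp.lmapDomain T A
    fun j ↦ (r.r ≫ g).hom ∘ₗ Finsupp.lsingle j), ?_⟩
  have : ModuleCat.ofHom (Finsupp.lmapDomain T A fun j ↦ (r.r ≫ g).hom ∘ₗ Finsupp.lsingle j) ≫
      ModuleCat.ofHom (Finsupp.lsum ℕ (id : (T →ₗ[A] M) → _)) = r.r ≫ g := by
    ext1
    refine Finsupp.lhom_ext fun j t ↦ ?_
    simp [Finsupp.mapDomain_single]
  rw [Category.assoc, this, r.retract_assoc]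

/-! ### Finendo modules and approximation of projectives. -/

/-- A finite family of elements of a finendo module `T` which generates it over its endomorphism
ring yields an element of a finite direct sum of copies of `T` whose images under linear maps
exhaust each module in `Gen(T)`. -/
lemma IsFinendo.exists_generator {T : ModuleCat.{u} A} (hT : IsFinendo T) :
    ∃ (J : Type u) (τ : J →₀ T), ∀ X : ModuleCat.{u} A, Gen T X → ∀ x : X,
      ∃ h : (J →₀ T) →ₗ[A] X, h τ = x := by
  obtain ⟨s, hs⟩ : (⊤ : Submodule (Module.End A T) T).FG := Module.Finite.fg_top (self := hT)
  let τ : s →₀ T := Finsupp.equivFunOnFinite.symm Subtype.val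
  have h₁ (t : T) : ∃ h : (s →₀ T) →ₗ[A] T, h τ = t := by
    have ht : t ∈ Submodule.span (Module.End A T) (s : Set T) := hs ▸ Submodule.mem_top
    induction ht using Submodule.span_induction with
    | mem x hx => exact ⟨Finsupp.lapply ⟨x, hx⟩, rfl⟩
    | zero => exact ⟨0, rfl⟩
    | add x y _ _ hx hy =>
      obtain ⟨f, rfl⟩ := hx
      obtain ⟨g, rfl⟩ := hy
      exact ⟨f + g, rfl⟩
    | smul a x _ hx =>
      obtain ⟨f, rfl⟩ := hx
      exact ⟨a ∘ₗ f, rfl⟩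
  refine ⟨s, τ, fun X hX x ↦ ?_⟩
  obtain ⟨J, p, hp⟩ := gen_iff.1 hX
  obtain ⟨y, rfl⟩ := hp x
  suffices h₂ : ∃ h : (s →₀ T) →ₗ[A] (J →₀ T), h τ = y by
    obtain ⟨h, rfl⟩ := h₂
    exact ⟨p ∘ₗ h, rfl⟩
  induction y using Finsupp.induction_linear with
  | zero => exact ⟨0, rfl⟩
  | add x y hx hy =>
    obtain ⟨f, rfl⟩ := hx
    obtain ⟨g, rfl⟩ := hy
    exact ⟨f + g, rfl⟩
  | single j t =>
    obtain ⟨h, rfl⟩ := h₁ t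
    exact ⟨Finsupp.lsingle j ∘ₗ h, rfl⟩

/-- For a finendo module `T`, projective modules have left `Gen(T)`-approximations with target in
`Add(T)`. -/
lemma IsFinendo.exists_approximation {T : ModuleCat.{u} A} (hT : IsFinendo T)
    (Q : ModuleCat.{u} A) [Projective Q] :
    ∃ (M : ModuleCat.{u} A) (f : Q ⟶ M), AddClass T M ∧
      ∀ X : ModuleCat.{u} A, Gen T X → ∀ g : Q ⟶ X, ∃ h : M ⟶ X, f ≫ h = g := by
  obtain ⟨J, τ, hτ⟩ := hT.exists_generator
  have : Module.Projective A Q := inferInstance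
  obtain ⟨s, hs⟩ := Module.projective_def'.1 this
  -- Here `s` embeds `Q` in the free module on its elements; the basis vector at `q` goes to `τ` in
  -- the copy indexed by `q`, which can then be mapped to `g q`.
  refine ⟨ModuleCat.of A (Q →₀ (J →₀ T)), ModuleCat.ofHom
    (Finsupp.mapRange.linearMap (LinearMap.toSpanSingleton A _ τ) ∘ₗ s),
    (AddClass.finsupp_self T J).finsupp Q, fun X hX g ↦ ?_⟩
  choose h hh using fun q : Q ↦ hτ X hX (g q)
  refine ⟨ModuleCat.ofHom (Finsupp.lsum ℕ h), ?_⟩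
  have key : Finsupp.lsum ℕ h ∘ₗ Finsupp.mapRange.linearMap (LinearMap.toSpanSingleton A _ τ) =
      g.hom ∘ₗ Finsupp.linearCombination A id := by
    refine Finsupp.lhom_ext fun q a ↦ ?_
    simp [Finsupp.mapRange_single, hh]
  ext1
  change Finsupp.lsum ℕ h ∘ₗ Finsupp.mapRange.linearMap (LinearMap.toSpanSingleton A _ τ) ∘ₗ s =
    g.hom
  rw [← LinearMap.comp_assoc, key, LinearMap.comp_assoc, hs, LinearMap.comp_id]

theorem IsQuasitilting.isSupportTauTilting {T : ModuleCat.{u} A} (hT : IsQuasitilting T)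
    (hfin : IsFinendo T) : IsSupportTauTilting (AddClass T) where
  additive := isAdditiveSubcategory_addClass T
  ext_vanishing T₁ T₂ h₁ h₂ X hX := by
    obtain ⟨Y, p, ⟨e⟩, hp⟩ := hX
    exact (hT.2.2 X ⟨Y, p, .of_retract (Retract.ofIso e) h₂, hp⟩).of_addClass h₁
  exists_presentation Q _ := by
    obtain ⟨M, f, hM, hf⟩ := hfin.exists_approximation Q
    refine ⟨M, cokernel f, f, cokernel.π f, cokernel.condition f, ShortComplex.exact_cokernel f,
      inferInstance, hM, addClass_of_isExtProjectiveIn hT.1 ⟨⟨M, cokernel.π f, hM, inferInstance⟩,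
        fun X hX ↦ ((hT.2.2 X hX).of_addClass hM).cokernel_of_factors f (hf X hX)⟩,
      hM, fun X hX ↦ hf X (Gen.of_addClass hX)⟩
  contravariantlyFinite := isContravariantlyFinite_addClass T

/-! ### Silting modules. -/

lemma pres_le_gen {T X : ModuleCat.{u} A} (h : Pres T X) : Gen T X := by
  obtain ⟨_, M₀, _, g, _, _, h₀, _, hg⟩ := h
  exact ⟨M₀, g, h₀, hg⟩

lemma IsSilting.isQuasitilting {S : ModuleCat.{u} A} (hS : IsSilting S) : IsQuasitilting S := by
  obtain ⟨P₁, P₀, σ, π, w, hP₁, hP₀, hσ, hπ, hgen⟩ := hS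
  refine ⟨?_, Gen.of_addClass (AddClass.self S), fun X hX ↦ ?_⟩
  · ext X
    refine ⟨pres_le_gen, fun hX ↦ ?_⟩
    obtain ⟨M, φ, hM, hφ⟩ := isContravariantlyFinite_addClass S X
    have : Epi φ := by
      obtain ⟨N, p, hN, hp⟩ := hX
      obtain ⟨h, rfl⟩ := hφ N hN p
      exact epi_of_epi h φ
    have hK : Gen S (kernel φ) := by
      rw [hgen]
      intro k
      have hMσ : homSurjectiveClass σ M := hgen ▸ Gen.of_addClass hM
      -- The extension `g` of `k` need not land in the kernel of `φ`. But `g ≫ φ` kills `σ`, so it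
      -- descends to `S` and lifts through the approximation `φ` to `h`; subtracting `π ≫ h`
      -- corrects `g` without changing its restriction along `σ`.
      obtain ⟨g, hg⟩ := hMσ (k ≫ kernel.ι φ)
      dsimp only at hg
      obtain ⟨d, hd⟩ : ∃ d : S ⟶ X, π ≫ d = g ≫ φ :=
        ⟨hσ.desc (g ≫ φ) (by simp [reassoc_of% hg]), hσ.g_desc _ _⟩
      obtain ⟨h, rfl⟩ := hφ S (AddClass.self S) d
      refine ⟨kernel.lift φ (g - π ≫ h) (by simp [hd]), ?_⟩
      rw [← cancel_mono (kernel.ι φ)]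
      simp [hg, reassoc_of% w]
    obtain ⟨N, p, hN, hp⟩ := hK
    refine ⟨N, M, p ≫ kernel.ι φ, φ, by simp, hN, hM, ?_, inferInstance⟩
    let α : ShortComplex.mk (p ≫ kernel.ι φ) φ (by simp) ⟶
        ShortComplex.mk (kernel.ι φ) φ (kernel.condition φ) := { τ₁ := p, τ₂ := 𝟙 _, τ₃ := 𝟙 _ }
    have : Epi α.τ₁ := hp
    have : IsIso α.τ₂ := inferInstanceAs (IsIso (𝟙 _))
    have : Mono α.τ₃ := inferInstanceAs (Mono (𝟙 _))
    exact (ShortComplex.exact_iff_of_epi_of_isIso_of_mono α).2 (ShortComplex.exact_kernel φ)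
  · rw [hgen] at hX
    refine ExtOneVanishes.of_exists_extension (shortExact_kernel π) (.of_projective P₀ X)
      fun g ↦ ?_
    have : Epi (kernel.lift π σ w) := hσ.epi_kernelLift
    obtain ⟨g', hg'⟩ := hX (kernel.lift π σ w ≫ g)
    refine ⟨g', ?_⟩
    rw [← cancel_epi (kernel.lift π σ w), ← hg']
    simp

/-- The class `𝒟_σ` is closed under products, so `S^S` is a quotient of some `S^(J)`. A preimage of
the tuple of all elements of `S` has finite support, and its coordinates generate `S` over its
endomorphisms. -/
lemma IsSilting.isFinendo {S : ModuleCat.{u} A} (hS : IsSilting S) : IsFinendo S := by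
  obtain ⟨P₁, P₀, σ, π, w, hP₁, hP₀, hσ, hπ, hgen⟩ := hS
  have hprod : Gen S (ModuleCat.of A (S → S)) := by
    rw [hgen]
    intro k
    have hS : homSurjectiveClass σ S := hgen ▸ Gen.of_addClass (AddClass.self S)
    choose g hg using fun s : S ↦ hS (k ≫ ModuleCat.ofHom (LinearMap.proj s))
    refine ⟨ModuleCat.ofHom (LinearMap.pi fun s ↦ (g s).hom), ?_⟩
    ext x s
    exact congr($(hg s) x)
  obtain ⟨J, p, hp⟩ := gen_iff.1 hprod
  obtain ⟨y, hy⟩ := hp id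
  refine Module.finite_def.2 (Submodule.fg_def.2 ⟨y '' y.support, y.support.finite_toSet.image y,
    eq_top_iff.2 fun s _ ↦ ?_⟩)
  have hs : s = y.sum fun j t ↦ (LinearMap.proj s ∘ₗ p ∘ₗ Finsupp.lsingle j : Module.End A S) t := by
    calc s = p y s := (congr_fun hy s).symm
      _ = (LinearMap.proj s ∘ₗ p : (J →₀ S) →ₗ[A] S) (y.sum Finsupp.single) := by
        rw [Finsupp.sum_single]; rfl
      _ = _ := by rw [Finsupp.sum, map_sum]; rfl
  rw [hs]
  exact Submodule.sum_mem _ fun j hj ↦ Submodule.smul_mem _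
    (LinearMap.proj s ∘ₗ p ∘ₗ Finsupp.lsingle j : Module.End A S)
    (Submodule.subset_span (Set.mem_image_of_mem y hj))

end Modules
end TauTilting

theorem mainTheorem8 (R : Type u) [Ring R] :
    (∀ T : ModuleCat.{u} Rᵐᵒᵖ, TauTilting.IsFinendo T → TauTilting.IsQuasitilting T →
      TauTilting.IsSupportTauTilting (TauTilting.AddClass T)) ∧
    (∀ S : ModuleCat.{u} Rᵐᵒᵖ, TauTilting.IsSilting S →
      TauTilting.IsSupportTauTilting (TauTilting.AddClass S)) :=
  ⟨fun _ hfin hT ↦ hT.isSupportTauTilting hfin,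
    fun _ hS ↦ hS.isQuasitilting.isSupportTauTilting hS.isFinendo⟩
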